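/- For $d \ge 1$ and a finite-dimensional complex vector space $V$, let $S^dV$ be the space of homogeneous polynomials of degree $d$ on $V^*$. For $P \in S^dV$ let the symmetric rank $R_s(P)$ be the least $r \in \mathbb{N}$ such that $P = \sum_{i=1}^r v_i^d$ for some $v_1,\dots,v_r \in V$, and let the symmetric border rank be $$\underline{R}_s(P) = \min\{ r \in \mathbb{N} : P \in \overline{\{T \in S^dV : R_s(T) = r\}} \},$$ where the overline denotes the Zariski closure in $S^dV$. Let $\det_3, \operatorname{perm}_3 \in S^3\mathbb{C}^9$ be the determinant and the permanent of the $3\times 3$ matrix whose entries are the nine coordinate variables. Then $$\underline{R}_s(\det\nolimits_3) \ge 14 \qquad\text{and}\qquad \underline{R}_s(\operatorname{perm}_3) \ge 14.$$ -/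

import Mathlib

/-- The linear form `∑ j, v j • X j` with coefficient vector `v`. -/
noncomputable def linForm {σ : Type*} [Fintype σ] (v : σ → ℂ) : MvPolynomial σ ℂ :=
  ∑ j, MvPolynomial.C (v j) * MvPolynomial.X j

/-- `P` is a sum of `r` many `d`-th powers of linear forms. -/
def IsSumOfPowers {σ : Type*} [Fintype σ] {d : ℕ}
    (P : MvPolynomial.homogeneousSubmodule σ ℂ d) (r : ℕ) : Prop :=
  ∃ v : Fin r → σ → ℂ, (P : MvPolynomial σ ℂ) = ∑ i, linForm (v i) ^ d

/-- The symmetric (Waring) rank of a form of degree `d`: the least `r` such that the form is a sum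
of `r` many `d`-th powers of linear forms (`⊤` if there is no such `r`, which can happen only for
`d = 0`). -/
noncomputable def symRank {σ : Type*} [Fintype σ] {d : ℕ}
    (P : MvPolynomial.homogeneousSubmodule σ ℂ d) : ℕ∞ :=
  ⨅ (r : ℕ) (_ : IsSumOfPowers P r), (r : ℕ∞)

/-- The Zariski closure of a subset `S` of a complex vector space `W`: the common zeros of all
polynomial functions on `W` (polynomials in linear functionals on `W`) that vanish on `S`. -/
def zariskiClosure {W : Type*} [AddCommGroup W] [Module ℂ W] (S : Set W) : Set W :=
  {w | ∀ f : MvPolynomial (Module.Dual ℂ W) ℂ,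
    (∀ s ∈ S, MvPolynomial.eval (fun φ : Module.Dual ℂ W => φ s) f = 0) →
      MvPolynomial.eval (fun φ : Module.Dual ℂ W => φ w) f = 0}

/-- The symmetric border rank of a form `P` of degree `d`: the least natural number `r` such that
`P` lies in the Zariski closure, inside the space of all forms of degree `d`, of the set of forms
of symmetric rank `r`. -/
noncomputable def symBorderRank {σ : Type*} [Fintype σ] {d : ℕ}
    (P : MvPolynomial.homogeneousSubmodule σ ℂ d) : ℕ :=
  sInf {r : ℕ | P ∈ zariskiClosure
    {T : MvPolynomial.homogeneousSubmodule σ ℂ d | symRank T = (r : ℕ∞)}}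

theorem isHomogeneous_prod_X {n : ℕ} (s : Equiv.Perm (Fin n)) :
    (∏ i, Matrix.mvPolynomialX (Fin n) (Fin n) ℂ (s i) i).IsHomogeneous n := by
  have h := MvPolynomial.IsHomogeneous.prod Finset.univ
    (fun i => Matrix.mvPolynomialX (Fin n) (Fin n) ℂ (s i) i) (fun _ => 1)
    (fun i _ => by
      simpa [Matrix.mvPolynomialX_apply] using MvPolynomial.isHomogeneous_X ℂ (s i, i))
  simpa using h

theorem isHomogeneous_det (n : ℕ) :
    (Matrix.mvPolynomialX (Fin n) (Fin n) ℂ).det.IsHomogeneous n := by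
  rw [Matrix.det_apply]
  refine MvPolynomial.IsHomogeneous.sum _ _ _ fun s _ => ?_
  have h : ∀ u : ℤˣ, (u • ∏ i, Matrix.mvPolynomialX (Fin n) (Fin n) ℂ (s i) i).IsHomogeneous n := by
    intro u
    rcases Int.units_eq_one_or u with rfl | rfl
    · simpa using isHomogeneous_prod_X s
    · simpa using (isHomogeneous_prod_X s).neg
  exact h _

theorem isHomogeneous_permanent (n : ℕ) :
    (Matrix.mvPolynomialX (Fin n) (Fin n) ℂ).permanent.IsHomogeneous n :=
  MvPolynomial.IsHomogeneous.sum _ _ _ fun s _ => isHomogeneous_prod_X s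

/-- The determinant of the generic `n × n` matrix, as a form of degree `n` in `n²` variables. -/
noncomputable def detForm (n : ℕ) : MvPolynomial.homogeneousSubmodule (Fin n × Fin n) ℂ n :=
  ⟨(Matrix.mvPolynomialX (Fin n) (Fin n) ℂ).det, isHomogeneous_det n⟩

/-- The permanent of the generic `n × n` matrix, as a form of degree `n` in `n²` variables. -/
noncomputable def permForm (n : ℕ) : MvPolynomial.homogeneousSubmodule (Fin n × Fin n) ℂ n :=
  ⟨(Matrix.mvPolynomialX (Fin n) (Fin n) ℂ).permanent, isHomogeneous_permanent n⟩

/-! Let `Φ` be a linear map from cubic forms to matrices whose value at every cube of a linear form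
has rank at most `6`. The minors of `Φ` are polynomial functions and having rank at most `q` is a
Zariski closed condition, so `rank (Φ P)` is at most `6` times the border rank of `P`. Such a `Φ` is
the Koszul flattening of Landsberg and Ottaviani: replace the entries of the Hessian matrix, which
are linear forms, by the wedge multiplications `Λ²ℂ⁵ → Λ³ℂ⁵` with their images under a linear map
`ℂ⁹ → ℂ⁵`. For a form `∑ s, χ s * ∏ i, x_{s(i), i}` with all `χ s` nonzero, the support of this
matrix does not depend on `χ`, and for a suitable map to `ℂ⁵` and a suitable order of the columns,
`80 > 6 * 13` columns contain the last nonzero entry of some row, so they are linearly independent.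
-/

open Matrix MvPolynomial

section Rank

variable {m n K : Type*} [Field K]

theorem matrix_rank_add_le [Fintype n] [Finite m] (A B : Matrix m n K) :
    (A + B).rank ≤ A.rank + B.rank := by
  have hrange : LinearMap.range (A + B).mulVecLin ≤
      LinearMap.range A.mulVecLin ⊔ LinearMap.range B.mulVecLin := by
    rw [mulVecLin_add]
    exact LinearMap.range_add_le _ _
  exact (Submodule.finrank_mono hrange).trans (Submodule.finrank_add_le_finrank_add_finrank _ _)

theorem matrix_rank_sum_le [Fintype n] [Finite m] {ι : Type*} (s : Finset ι)
    (A : ι → Matrix m n K) : (∑ i ∈ s, A i).rank ≤ ∑ i ∈ s, (A i).rank :=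
  Finset.le_sum_of_subadditive (fun B : Matrix m n K ↦ B.rank) rank_zero.le
    matrix_rank_add_le s A

theorem exists_linearIndependent_rows [Fintype n] [Finite m] {A : Matrix m n K} {r : ℕ}
    (hr : r ≤ A.rank) : ∃ f : Fin r → m, LinearIndependent K (A.submatrix f id).row := by
  rw [rank_eq_finrank_span_row] at hr
  obtain ⟨v, hv, -, hli⟩ := Submodule.exists_fun_fin_finrank_span_eq K (Set.range A.row)
  choose f hf using hv
  rw [← funext hf] at hli
  exact ⟨f ∘ Fin.castLE hr, hli.comp _ (Fin.castLE_injective hr)⟩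

theorem exists_det_submatrix_ne_zero [Fintype n] [Finite m] {A : Matrix m n K} {r : ℕ}
    (hr : r ≤ A.rank) : ∃ (f : Fin r → m) (g : Fin r → n), (A.submatrix f g).det ≠ 0 := by
  obtain ⟨f, hf⟩ := exists_linearIndependent_rows hr
  have hr' : r ≤ (A.submatrix f id)ᵀ.rank := by
    rw [rank_transpose, hf.rank_matrix, Fintype.card_fin]
  obtain ⟨g, hg⟩ := exists_linearIndependent_rows hr'
  exact ⟨f, g, ((isUnit_iff_isUnit_det _).1 (linearIndependent_cols_iff_isUnit.1 hg)).ne_zero⟩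

theorem card_le_rank_of_linearIndepOn_col [Fintype n] [Finite m] {A : Matrix m n K} {s : Finset n}
    (hs : LinearIndepOn K A.col s) : s.card ≤ A.rank := by
  rw [rank_eq_finrank_span_cols, ← Fintype.card_coe s]
  exact (finrank_span_eq_card hs).symm.trans_le
    (Submodule.finrank_mono (Submodule.span_mono (by rintro _ ⟨j, rfl⟩; exact ⟨_, rfl⟩)))

theorem linearIndepOn_col_of_leading {α : Type*} [LinearOrder α] (key : n → α)
    {A : Matrix m n K} {s : Finset n}
    (hs : ∀ j ∈ s, ∃ i, A i j ≠ 0 ∧ ∀ j' ∈ s, j' ≠ j → key j ≤ key j' → A i j' = 0) :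
    LinearIndepOn K A.col s := by
  classical
  rw [linearIndepOn_finset_iff]
  intro c hc
  by_contra! hne
  obtain ⟨j, hj, hmin⟩ := Finset.exists_min_image {j ∈ s | c j ≠ 0} key
    (by simpa [Finset.Nonempty] using hne)
  simp only [Finset.mem_filter] at hj hmin
  obtain ⟨i, hij, hvanish⟩ := hs j hj.1
  have hrow : ∑ j' ∈ s, c j' * A i j' = c j * A i j := by
    refine Finset.sum_eq_single_of_mem j hj.1 fun j' hj' hjj' ↦ ?_
    by_cases hcj' : c j' = 0
    · rw [hcj', zero_mul]
    · rw [hvanish j' hj' hjj' (hmin j' ⟨hj', hcj'⟩), mul_zero]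
  have hzero : ∑ j' ∈ s, c j' * A i j' = 0 := by simpa using congrFun hc i
  exact mul_ne_zero hj.2 hij (hrow.symm.trans hzero)

end Rank

section ZariskiClosure

variable {W : Type*} [AddCommGroup W] [Module ℂ W]

theorem subset_zariskiClosure (S : Set W) : S ⊆ zariskiClosure S :=
  fun _ hw _ hf ↦ hf _ hw

theorem rank_le_of_mem_zariskiClosure {m n : Type*} [Finite m] [Fintype n] {S : Set W}
    (Φ : W →ₗ[ℂ] Matrix m n ℂ) {q : ℕ} (hΦ : ∀ w ∈ S, (Φ w).rank ≤ q) {w : W}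
    (hw : w ∈ zariskiClosure S) : (Φ w).rank ≤ q := by
  by_contra! hq
  obtain ⟨f, g, hfg⟩ := exists_det_submatrix_ne_zero (Nat.succ_le_of_lt hq)
  let entry (i : m) (j : n) : Module.Dual ℂ W := entryLinearMap ℂ ℂ i j ∘ₗ Φ
  let minor : MvPolynomial (Module.Dual ℂ W) ℂ := (of fun i j ↦ X (entry (f i) (g j))).det
  have hminor (u : W) : eval (fun φ : Module.Dual ℂ W ↦ φ u) minor =
      ((Φ u).submatrix f g).det := by
    rw [RingHom.map_det]
    congr 1
    ext i j
    simp [entry]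
  refine hfg ((hminor w).symm.trans (hw minor fun u hu ↦ ?_))
  rw [hminor]
  by_contra hdet
  have hrank := (rank_of_det_ne_zero hdet).symm.trans_le (rank_submatrix_le (Φ u) f g)
  rw [Fintype.card_fin] at hrank
  exact absurd (hΦ u hu) (by lia)

end ZariskiClosure

section Waring

variable {σ : Type*} [Fintype σ] {d : ℕ}

theorem linForm_smul (t : ℂ) (v : σ → ℂ) : linForm (t • v) = t • linForm v := by
  simp [linForm, smul_eq_C_mul, Finset.mul_sum, mul_assoc]

theorem isHomogeneous_linForm (v : σ → ℂ) : (linForm v).IsHomogeneous 1 :=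
  IsHomogeneous.sum _ _ _ fun j _ ↦ by
    simpa using (isHomogeneous_C σ (v j)).mul (isHomogeneous_X ℂ j)

theorem linForm_pow_eq_sum_monomial [DecidableEq σ] (d : ℕ) (v : σ → ℂ) :
    linForm v ^ d = ∑ s ∈ Finset.univ.finsuppAntidiag d,
      (s.multinomial * s.prod fun j e ↦ v j ^ e) • monomial s 1 := by
  ext s
  have hlin : linForm v = ∑ j, v j • X j := by simp only [linForm, smul_eq_C_mul]
  have hdeg : s ∈ Finset.univ.finsuppAntidiag d ↔ s.sum (fun _ e ↦ e) = d := by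
    rw [Finset.mem_finsuppAntidiag, s.sum_fintype _ fun _ ↦ rfl]
    simp
  simp [hlin, coeff_linearCombination_X_pow_of_fintype, coeff_sum, coeff_monomial, hdeg]

theorem dual_monomial_eq_zero [DecidableEq σ] {φ : Module.Dual ℂ (MvPolynomial σ ℂ)}
    (hφ : ∀ v : σ → ℂ, φ (linForm v ^ d) = 0) {s : σ →₀ ℕ}
    (hs : s ∈ Finset.univ.finsuppAntidiag d) : φ (monomial s 1) = 0 := by
  -- As a function of `v`, `φ (linForm v ^ d)` is a polynomial with these coefficients.
  let Q : MvPolynomial σ ℂ := ∑ s ∈ Finset.univ.finsuppAntidiag d,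
    monomial s (s.multinomial * φ (monomial s 1))
  have hQ : Q = 0 := by
    refine funext fun v ↦ ?_
    rw [map_zero, ← hφ v, linForm_pow_eq_sum_monomial, map_sum, map_sum]
    refine Finset.sum_congr rfl fun s _ ↦ ?_
    rw [eval_monomial, map_smul, smul_eq_mul, mul_right_comm]
  have hcoeff : coeff s Q = s.multinomial * φ (monomial s 1) := by
    simp [Q, coeff_sum, coeff_monomial, hs]
  rw [hQ, coeff_zero] at hcoeff
  exact (mul_eq_zero.1 hcoeff.symm).resolve_left
    (Nat.cast_ne_zero.2 (Nat.multinomial_pos _ _).ne')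

theorem homogeneousSubmodule_le_span_linForm_pow (d : ℕ) :
    homogeneousSubmodule σ ℂ d ≤
      Submodule.span ℂ (Set.range fun v : σ → ℂ ↦ linForm v ^ d) := by
  classical
  intro P hP
  by_contra hspan
  obtain ⟨φ, hφP, hφ⟩ := Submodule.exists_le_ker_of_notMem hspan
  refine hφP ?_
  rw [P.as_sum, map_sum]
  refine Finset.sum_eq_zero fun s hs ↦ ?_
  have hdeg : s ∈ Finset.univ.finsuppAntidiag d := by
    have := hP (mem_support_iff.1 hs)
    simpa [Finset.mem_finsuppAntidiag, Finsupp.weight_apply, Finsupp.sum_fintype] using this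
  have hmonomial := dual_monomial_eq_zero (fun v ↦ hφ (Submodule.subset_span ⟨v, rfl⟩)) hdeg
  rw [← mul_one (coeff s P), ← smul_eq_mul, ← smul_monomial, map_smul, hmonomial, smul_zero]

theorem exists_isSumOfPowers (hd : d ≠ 0) (P : homogeneousSubmodule σ ℂ d) :
    ∃ r, IsSumOfPowers P r := by
  obtain ⟨r, c, w, hP⟩ :=
    Submodule.mem_span_set'.1 (homogeneousSubmodule_le_span_linForm_pow d P.2)
  choose v hv using fun i ↦ (w i).2
  choose t ht using fun i ↦ IsAlgClosed.exists_pow_nat_eq (c i) (Nat.pos_of_ne_zero hd)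
  refine ⟨r, fun i ↦ t i • v i, hP.symm.trans (Finset.sum_congr rfl fun i _ ↦ ?_)⟩
  rw [linForm_smul, smul_pow, ht, ← hv]

end Waring

section BorderRank

variable {σ : Type*} [Fintype σ] {d : ℕ}

/-- The `d`-th power of a linear form, as a form of degree `d`. -/
noncomputable def linPow (d : ℕ) (v : σ → ℂ) : homogeneousSubmodule σ ℂ d :=
  ⟨linForm v ^ d, by simpa using (isHomogeneous_linForm v).pow d⟩

theorem exists_isSumOfPowers_le_of_symRank_eq {T : homogeneousSubmodule σ ℂ d} {r : ℕ}
    (hT : symRank T = r) : ∃ q ≤ r, IsSumOfPowers T q := by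
  have hlt : symRank T < (r + 1 : ℕ) := by
    rw [hT]
    exact_mod_cast r.lt_succ_self
  obtain ⟨q, hq⟩ := iInf_lt_iff.1 hlt
  obtain ⟨hTq, hqr⟩ := iInf_lt_iff.1 hq
  exact ⟨q, Nat.lt_succ_iff.1 (by exact_mod_cast hqr), hTq⟩

theorem mem_zariskiClosure_symRank_eq_symBorderRank (hd : d ≠ 0)
    (P : homogeneousSubmodule σ ℂ d) :
    P ∈ zariskiClosure {T : homogeneousSubmodule σ ℂ d | symRank T = symBorderRank P} := by
  obtain ⟨r, hr⟩ := exists_isSumOfPowers hd P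
  have hfinite : symRank P ≠ ⊤ := ((iInf₂_le r hr).trans_lt (ENat.natCast_lt_top r)).ne
  obtain ⟨q, hq⟩ := ENat.ne_top_iff_exists.1 hfinite
  exact Nat.sInf_mem (s := {r | P ∈ zariskiClosure {T | symRank T = (r : ℕ∞)}})
    ⟨q, subset_zariskiClosure _ hq.symm⟩

theorem rank_le_symRank_mul {m n : Type*} [Finite m] [Fintype n]
    (Φ : homogeneousSubmodule σ ℂ d →ₗ[ℂ] Matrix m n ℂ) {k : ℕ}
    (hΦ : ∀ v, (Φ (linPow d v)).rank ≤ k) {T : homogeneousSubmodule σ ℂ d} {r : ℕ}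
    (hT : symRank T = r) : (Φ T).rank ≤ r * k := by
  obtain ⟨q, hqr, v, hv⟩ := exists_isSumOfPowers_le_of_symRank_eq hT
  have hsum : T = ∑ i, linPow d (v i) := Subtype.ext (by simp [hv, linPow])
  calc (Φ T).rank = (∑ i, Φ (linPow d (v i))).rank := by rw [hsum, map_sum]
    _ ≤ ∑ i, (Φ (linPow d (v i))).rank := matrix_rank_sum_le _ _
    _ ≤ q * k := by simpa using Finset.sum_le_card_nsmul Finset.univ _ k fun i _ ↦ hΦ (v i)
    _ ≤ r * k := Nat.mul_le_mul_right k hqr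

theorem rank_le_symBorderRank_mul {m n : Type*} [Finite m] [Fintype n] (hd : d ≠ 0)
    (Φ : homogeneousSubmodule σ ℂ d →ₗ[ℂ] Matrix m n ℂ) {k : ℕ}
    (hΦ : ∀ v, (Φ (linPow d v)).rank ≤ k) (P : homogeneousSubmodule σ ℂ d) :
    (Φ P).rank ≤ symBorderRank P * k :=
  rank_le_of_mem_zariskiClosure Φ (fun _ hT ↦ rank_le_symRank_mul Φ hΦ hT)
    (mem_zariskiClosure_symRank_eq_symBorderRank hd P)

end BorderRank

section Alternating

variable {K M E : Type*} [Field K] [AddCommGroup M] [Module K M] [AddCommGroup E] [Module K E]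
  {p : ℕ}

theorem finrank_span_le_of_subset_range_alternatingMap [FiniteDimensional K M]
    (B : M [⋀^Fin p]→ₗ[K] E) {S : Set E} (hS : S ⊆ Set.range B) :
    Module.finrank K (Submodule.span K S) ≤ (Module.finrank K M).choose p := by
  have hspan : Submodule.span K S ≤
      LinearMap.range (exteriorPower.alternatingMapLinearEquiv B) := by
    rw [Submodule.span_le]
    intro x hx
    obtain ⟨v, rfl⟩ := hS hx
    exact ⟨_, exteriorPower.alternatingMapLinearEquiv_apply_ιMulti B v⟩
  calc Module.finrank K (Submodule.span K S)
      ≤ Module.finrank K (LinearMap.range (exteriorPower.alternatingMapLinearEquiv B)) :=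
        Submodule.finrank_mono hspan
    _ ≤ Module.finrank K (⋀[K]^p M) := LinearMap.finrank_range_le _
    _ = (Module.finrank K M).choose p := exteriorPower.finrank_eq K p

theorem curryLeft_add_smul_self (B : M [⋀^Fin (p + 1)]→ₗ[K] E) (u : M) (v : Fin p → M)
    (c : Fin p → K) : B.curryLeft u (v + fun i ↦ c i • u) = B.curryLeft u v := by
  have hvanish (w : Fin p → M) (i : Fin p) (t : K) (hi : w i = t • u) : B.curryLeft u w = 0 := by
    have hsame : B.curryLeft u (Function.update w i u) = 0 :=
      B.map_eq_zero_of_eq _ (i := 0) (j := i.succ) (by simp) (Fin.succ_ne_zero i).symm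
    rw [← Function.update_eq_self i w, hi, AlternatingMap.map_update_smul, hsame, smul_zero]
  rw [AlternatingMap.map_add_univ, Finset.sum_eq_single_of_mem Finset.univ (Finset.mem_univ _),
    Finset.piecewise_univ]
  intro s _ hs
  obtain ⟨i, hi⟩ : ∃ i, i ∉ s := by simpa [Finset.eq_univ_iff_forall] using hs
  exact hvanish _ i (c i) (Finset.piecewise_eq_of_notMem _ _ _ hi)

theorem finrank_span_range_curryLeft_le [FiniteDimensional K M] (B : M [⋀^Fin (p + 1)]→ₗ[K] E)
    (u : M) : Module.finrank K (Submodule.span K (Set.range (B.curryLeft u))) ≤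
      (Module.finrank K M - 1).choose p := by
  rcases eq_or_ne u 0 with rfl | hu
  · have hzero : Set.range (B.curryLeft 0) ⊆ {0} := by
      rintro _ ⟨v, rfl⟩
      simp
    rw [Submodule.span_eq_bot.2 fun _ hx ↦ hzero hx, finrank_bot]
    exact Nat.zero_le _
  obtain ⟨N, hN⟩ := Submodule.exists_isCompl (Submodule.span K {u})
  have hfinrank : Module.finrank K N = Module.finrank K M - 1 := by
    have := Submodule.finrank_add_eq_of_isCompl hN
    rw [finrank_span_singleton hu] at this
    lia
  rw [← hfinrank]
  refine finrank_span_le_of_subset_range_alternatingMap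
    ((B.curryLeft u).compLinearMap N.subtype) ?_
  rintro _ ⟨v, rfl⟩
  have hv (i : Fin p) : ∃ (x : N) (c : K), v i = x + c • u := by
    obtain ⟨y, hy, x, hx, hyx⟩ := Submodule.mem_sup.1
      (hN.sup_eq_top.symm ▸ Submodule.mem_top : v i ∈ Submodule.span K {u} ⊔ N)
    obtain ⟨c, rfl⟩ := Submodule.mem_span_singleton.1 hy
    exact ⟨⟨x, hx⟩, c, by rw [← hyx, add_comm]⟩
  choose x c hxc using hv
  exact ⟨x, by rw [funext hxc]; exact (curryLeft_add_smul_self B u _ c).symm⟩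

end Alternating

section Koszul

variable {σ : Type*}

/-- The alternating map `(x, y, z) ↦ (det (eᵢ, eⱼ, x, y, z))ᵢⱼ` on `ℂ⁵`: the exterior product
`Λ³ℂ⁵ → Λ⁵ℂ⁵ ≅ ℂ` with `eᵢ ∧ eⱼ`, for all `i` and `j` at once. -/
noncomputable def wedgeAlternating : (Fin 5 → ℂ) [⋀^Fin 3]→ₗ[ℂ] (Fin 5 × Fin 5 → ℂ) :=
  AlternatingMap.pi fun p ↦
    ((detRowAlternating (n := Fin 5)).curryLeft (Pi.single p.1 1)).curryLeft (Pi.single p.2 1)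

/-- The matrix of the multiplication `u ∧ · : Λ²ℂ⁵ → Λ³ℂ⁵`, where `Λ³ℂ⁵` is identified with the
dual of `Λ²ℂ⁵`. Rows and columns are indexed by all pairs `(i, j)`, standing for `eᵢ ∧ eⱼ`, so each
basis vector of `Λ²ℂ⁵` occurs twice, up to sign. -/
noncomputable def wedgeMatrix :
    (Fin 5 → ℂ) →ₗ[ℂ] Matrix (Fin 5 × Fin 5) (Fin 5 × Fin 5) ℂ where
  toFun u := of fun p q ↦ wedgeAlternating.curryLeft u ![Pi.single q.1 1, Pi.single q.2 1] p
  map_add' u v := by ext; simp only [map_add]; rfl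
  map_smul' c u := by ext; simp only [map_smul]; rfl

theorem rank_wedgeMatrix_le (u : Fin 5 → ℂ) : (wedgeMatrix u).rank ≤ 6 := by
  have hcol : Set.range (wedgeMatrix u).col ⊆ Set.range (wedgeAlternating.curryLeft u) := by
    rintro _ ⟨q, rfl⟩
    exact ⟨_, rfl⟩
  rw [rank_eq_finrank_span_cols]
  calc _ ≤ _ := Submodule.finrank_mono (Submodule.span_mono hcol)
    _ ≤ (Module.finrank ℂ (Fin 5 → ℂ) - 1).choose 2 := finrank_span_range_curryLeft_le _ u
    _ = 6 := by rw [Module.finrank_fin_fun]; rfl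

theorem submatrix_one_det_ne_zero_iff {n R : Type*} [Fintype n] [DecidableEq n] [CommRing R]
    [Nontrivial R] (f : n → n) :
    ((1 : Matrix n n R).submatrix f id).det ≠ 0 ↔ Function.Injective f := by
  constructor
  · intro hdet i j hij
    by_contra hne
    exact hdet (det_zero_of_row_eq hne (congrArg (1 : Matrix n n R) hij))
  · intro hf
    lift f to Equiv.Perm n using Finite.injective_iff_bijective.1 hf
    rw [det_permute, det_one, mul_one]
    exact ((Equiv.Perm.sign f).isUnit.map (Int.castRingHom R)).ne_zero

theorem injective_iff_sum_two_pow_eq (f : Fin 5 → Fin 5) :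
    Function.Injective f ↔ ∑ i, 2 ^ (f i).val = 31 := by
  constructor
  · intro hf
    exact (Function.Bijective.sum_comp (Finite.injective_iff_bijective.1 hf)
      fun i ↦ 2 ^ i.val).trans rfl
  · intro hsum
    have hnodup : ∀ a b c d e : Fin 5,
        2 ^ a.val + 2 ^ b.val + 2 ^ c.val + 2 ^ d.val + 2 ^ e.val = 31 → [a, b, c, d, e].Nodup := by
      decide +kernel
    rw [Fin.sum_univ_five] at hsum
    exact List.nodup_ofFn.1 (hnodup _ _ _ _ _ hsum)

/-- The indices in `p`, `m` and `q` are pairwise distinct, so that `e_p ∧ e_m ∧ e_q ≠ 0`. Five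
elements of `Fin 5` are distinct if and only if the corresponding powers of two sum to `31`; this
form is fast to evaluate. -/
def WedgeNeZero (p : Fin 5 × Fin 5) (m : Fin 5) (q : Fin 5 × Fin 5) : Prop :=
  2 ^ p.1.val + 2 ^ p.2.val + 2 ^ m.val + 2 ^ q.1.val + 2 ^ q.2.val = 31

instance (p : Fin 5 × Fin 5) (m : Fin 5) (q : Fin 5 × Fin 5) : Decidable (WedgeNeZero p m q) :=
  inferInstanceAs (Decidable (_ = _))

theorem wedgeMatrix_single_ne_zero_iff (p : Fin 5 × Fin 5) (m : Fin 5) (q : Fin 5 × Fin 5) :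
    wedgeMatrix (Pi.single m 1) p q ≠ 0 ↔ WedgeNeZero p m q := by
  let f : Fin 5 → Fin 5 := ![p.1, p.2, m, q.1, q.2]
  have hrows : (of fun t ↦ Pi.single (f t) 1 : Matrix (Fin 5) (Fin 5) ℂ) =
      (1 : Matrix (Fin 5) (Fin 5) ℂ).submatrix f id := by
    ext s t
    simp [one_apply, Pi.single_apply, eq_comm]
  have hdet : wedgeMatrix (Pi.single m 1) p q =
      (of fun t ↦ Pi.single (f t) 1 : Matrix (Fin 5) (Fin 5) ℂ).det := by
    simp only [wedgeMatrix, wedgeAlternating, LinearMap.coe_mk, AddHom.coe_mk, of_apply,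
      AlternatingMap.curryLeft_apply_apply, AlternatingMap.pi_apply]
    refine congrArg (detRowAlternating (n := Fin 5) (R := ℂ)) (funext fun t ↦ ?_)
    fin_cases t <;> rfl
  rw [hdet, hrows, submatrix_one_det_ne_zero_iff, injective_iff_sum_two_pow_eq, Fin.sum_univ_five]
  rfl

open scoped Kronecker in
theorem rank_vecMulVec_kronecker_le {m n m' n' K : Type*} [CommRing K] [StrongRankCondition K]
    [Finite m] [Fintype n] [Finite m'] [Fintype n'] (v : m → K) (w : n → K)
    (W : Matrix m' n' K) : (vecMulVec v w ⊗ₖ W).rank ≤ W.rank := by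
  classical
  cases nonempty_fintype m
  cases nonempty_fintype m'
  let E : Matrix (m × m') (n × n') K := W.submatrix Prod.snd Prod.snd
  have hfactor : vecMulVec v w ⊗ₖ W =
      diagonal (fun x : m × m' ↦ v x.1) * E * diagonal (fun y : n × n' ↦ w y.1) := by
    ext x y
    simp only [kroneckerMap_apply, vecMulVec_apply, mul_diagonal, diagonal_mul, submatrix_apply, E]
    ring
  rw [hfactor]
  exact (rank_mul_le_left _ _).trans ((rank_mul_le_right _ _).trans (rank_submatrix_le W _ _))

/-- The third-order partial derivative in the variables `x 0`, `x 1`, `x 2`, evaluated at `0`. -/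
noncomputable def thirdPartial (x : Fin 3 → σ) : MvPolynomial σ ℂ →ₗ[ℂ] ℂ :=
  (aeval (0 : σ → ℂ)).toLinearMap ∘ₗ (pderiv (x 0)).toLinearMap ∘ₗ (pderiv (x 1)).toLinearMap ∘ₗ
    (pderiv (x 2)).toLinearMap

theorem thirdPartial_apply (x : Fin 3 → σ) (P : MvPolynomial σ ℂ) :
    thirdPartial x P = eval 0 (pderiv (x 0) (pderiv (x 1) (pderiv (x 2) P))) := by
  simp [thirdPartial]

variable [Fintype σ]

theorem pderiv_linForm (v : σ → ℂ) (j : σ) : pderiv j (linForm v) = C (v j) := by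
  classical
  simp [linForm, pderiv_X, Pi.single_apply]

theorem thirdPartial_linForm_pow (v : σ → ℂ) (x : Fin 3 → σ) :
    thirdPartial x (linForm v ^ 3) = 6 * (v (x 0) * v (x 1) * v (x 2)) := by
  simp only [thirdPartial_apply, pow_succ, pow_zero, one_mul, Derivation.leibniz, pderiv_linForm,
    smul_eq_mul, map_add, map_mul, derivation_C, mul_zero, zero_add, add_zero, eval_zero,
    constantCoeff_C]
  ring

/-- The Koszul flattening `Λ²ℂ⁵ ⊗ V* → Λ³ℂ⁵ ⊗ V` of a cubic form on `V* = ℂ^σ`, along the linear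
map `V → ℂ⁵` that sends the variable `c` to `π c`: its block at the variables `(a, b)` is the
multiplication `Λ²ℂ⁵ → Λ³ℂ⁵` by the image of the linear form `∂³T/∂a∂b`. -/
noncomputable def koszulFlattening (π : σ → Fin 5 → ℂ) : homogeneousSubmodule σ ℂ 3 →ₗ[ℂ]
    Matrix (σ × Fin 5 × Fin 5) (σ × Fin 5 × Fin 5) ℂ where
  toFun T := of fun x y ↦ wedgeMatrix (∑ c, thirdPartial ![x.1, y.1, c] T • π c) x.2 y.2
  map_add' T S := by
    ext
    simp [add_smul, Finset.sum_add_distrib]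
  map_smul' t T := by
    ext
    simp [mul_smul, ← Finset.smul_sum]

theorem koszulFlattening_apply (π : σ → Fin 5 → ℂ) (T : homogeneousSubmodule σ ℂ 3)
    (x y : σ × Fin 5 × Fin 5) : koszulFlattening π T x y =
      wedgeMatrix (∑ c, thirdPartial ![x.1, y.1, c] (T : MvPolynomial σ ℂ) • π c) x.2 y.2 :=
  rfl

theorem rank_koszulFlattening_linPow_le (π : σ → Fin 5 → ℂ) (v : σ → ℂ) :
    (koszulFlattening π (linPow 3 v)).rank ≤ 6 := by
  let u : Fin 5 → ℂ := ∑ c, (6 * v c) • π c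
  have hkronecker : koszulFlattening π (linPow 3 v) =
      kroneckerMap (· * ·) (vecMulVec v v) (wedgeMatrix u) := by
    ext x y
    have hblock : ∑ c, thirdPartial ![x.1, y.1, c] (linForm v ^ 3) • π c =
        (v x.1 * v y.1) • u := by
      rw [Finset.smul_sum]
      refine Finset.sum_congr rfl fun c _ ↦ ?_
      rw [thirdPartial_linForm_pow, smul_smul]
      congr 1
      simp only [cons_val]
      ring
    rw [koszulFlattening_apply, linPow, hblock, map_smul, Matrix.smul_apply, kroneckerMap_apply,
      vecMulVec_apply, smul_eq_mul]
  rw [hkronecker]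
  exact (rank_vecMulVec_kronecker_le v v _).trans (rank_wedgeMatrix_le u)

end Koszul

section MatrixFunction

variable {n : ℕ}

/-- The generalized matrix function `∑ s, χ s * ∏ i, x_{s(i), i}` of the generic `n × n` matrix, as
a form of degree `n`. -/
noncomputable def matrixFunctionForm (χ : Equiv.Perm (Fin n) → ℂ) :
    homogeneousSubmodule (Fin n × Fin n) ℂ n :=
  ∑ s, χ s • ⟨∏ i, mvPolynomialX (Fin n) (Fin n) ℂ (s i) i, isHomogeneous_prod_X s⟩

theorem detForm_eq_matrixFunctionForm :
    detForm n = matrixFunctionForm fun s ↦ (Equiv.Perm.sign s : ℂ) := by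
  ext1
  simp [detForm, matrixFunctionForm, det_apply', smul_eq_C_mul]

theorem permForm_eq_matrixFunctionForm : permForm n = matrixFunctionForm fun _ ↦ 1 := by
  ext1
  simp [permForm, matrixFunctionForm, permanent]

theorem pderiv_prod_X (s : Fin n → Fin n) (t : Finset (Fin n)) (c : Fin n × Fin n) :
    pderiv c (∏ i ∈ t, X (s i, i) : MvPolynomial (Fin n × Fin n) ℂ) =
      if c.2 ∈ t ∧ s c.2 = c.1 then ∏ i ∈ t.erase c.2, X (s i, i) else 0 := by
  have hvanish {t : Finset (Fin n)} (ht : ∀ i ∈ t, (s i, i) ≠ c) :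
      pderiv c (∏ i ∈ t, X (s i, i) : MvPolynomial (Fin n × Fin n) ℂ) = 0 :=
    Finset.prod_induction _ (fun f ↦ pderiv c f = 0) (fun f g hf hg ↦ by simp [hf, hg])
      pderiv_one fun i hi ↦ pderiv_X_of_ne (ht i hi)
  split_ifs with hc
  · have hXc : (X (s c.2, c.2) : MvPolynomial (Fin n × Fin n) ℂ) = X c := by rw [hc.2]
    rw [← Finset.mul_prod_erase t _ hc.1, pderiv_mul, hXc, pderiv_X_self, one_mul, hvanish,
      mul_zero, add_zero]
    rintro i hi rfl
    exact Finset.notMem_erase _ _ hi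
  · refine hvanish fun i hi h ↦ hc ?_
    subst h
    exact ⟨hi, rfl⟩

theorem thirdPartial_prod_X (x : Fin 3 → Fin 3 × Fin 3) (s : Fin 3 → Fin 3) :
    thirdPartial x (∏ i, X (s i, i)) =
      if Function.Injective (Prod.snd ∘ x) ∧ ∀ t, s (x t).2 = (x t).1 then 1 else 0 := by
  have hinjective : Function.Injective (Prod.snd ∘ x) ↔
      (x 1).2 ≠ (x 2).2 ∧ (x 0).2 ≠ (x 1).2 ∧ (x 0).2 ≠ (x 2).2 := by
    change _ ↔ (Prod.snd ∘ x) 1 ≠ (Prod.snd ∘ x) 2 ∧ (Prod.snd ∘ x) 0 ≠ (Prod.snd ∘ x) 1 ∧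
      (Prod.snd ∘ x) 0 ≠ (Prod.snd ∘ x) 2
    generalize Prod.snd ∘ x = i
    decide +revert
  have hforall : (∀ t, s (x t).2 = (x t).1) ↔
      s (x 2).2 = (x 2).1 ∧ s (x 1).2 = (x 1).1 ∧ s (x 0).2 = (x 0).1 := by
    simp only [Fin.forall_fin_succ, IsEmpty.forall_iff, and_true]
    exact ⟨fun h ↦ ⟨h.2.2, h.2.1, h.1⟩, fun h ↦ ⟨h.2.2, h.2.1, h.1⟩⟩
  have hempty (hne : (x 1).2 ≠ (x 2).2 ∧ (x 0).2 ≠ (x 1).2 ∧ (x 0).2 ≠ (x 2).2) :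
      ((Finset.univ.erase (x 2).2).erase (x 1).2).erase (x 0).2 = ∅ := by
    generalize (x 0).2 = i, (x 1).2 = j, (x 2).2 = k at hne
    decide +revert
  simp only [thirdPartial_apply, pderiv_prod_X, apply_ite (pderiv _), apply_ite (eval _), map_zero,
    ← ite_and, Finset.mem_erase, Finset.mem_univ, hinjective, hforall]
  split_ifs with hx hx' hx'
  · rw [hempty hx'.1, Finset.prod_empty, map_one]
  · tauto
  · tauto
  · rfl

theorem thirdPartial_matrixFunctionForm_ne_zero_iff {χ : Equiv.Perm (Fin 3) → ℂ}
    (hχ : ∀ s, χ s ≠ 0) (x : Fin 3 → Fin 3 × Fin 3) :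
    thirdPartial x (matrixFunctionForm χ) ≠ 0 ↔
      Function.Injective (Prod.fst ∘ x) ∧ Function.Injective (Prod.snd ∘ x) := by
  have hsum : thirdPartial x (matrixFunctionForm χ) = ∑ s, χ s *
      if Function.Injective (Prod.snd ∘ x) ∧ ∀ t, s (x t).2 = (x t).1 then 1 else 0 := by
    simp only [matrixFunctionForm, Submodule.coe_sum, Submodule.coe_smul, map_sum, map_smul,
      mvPolynomialX_apply, thirdPartial_prod_X, smul_eq_mul]
  rw [hsum]
  constructor
  · intro hne
    obtain ⟨s, -, hs⟩ := Finset.exists_ne_zero_of_sum_ne_zero hne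
    obtain ⟨hsnd, hrow⟩ := (ite_ne_right_iff.1 (right_ne_zero_of_mul hs)).1
    have hfst : Prod.fst ∘ x = s ∘ Prod.snd ∘ x := funext fun t ↦ (hrow t).symm
    exact ⟨hfst ▸ s.injective.comp hsnd, hsnd⟩
  · rintro ⟨hfst, hsnd⟩
    let rows : Equiv.Perm (Fin 3) := .ofBijective _ (Finite.injective_iff_bijective.1 hfst)
    let cols : Equiv.Perm (Fin 3) := .ofBijective _ (Finite.injective_iff_bijective.1 hsnd)
    have hperm (s : Equiv.Perm (Fin 3)) : (∀ t, s (x t).2 = (x t).1) ↔ s = rows * cols⁻¹ := by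
      rw [eq_mul_inv_iff_mul_eq, Equiv.ext_iff]
      rfl
    simp [hsnd, hperm, hχ]

end MatrixFunction

section Certificate

/-- The index of the basis vector of `ℂ⁵` to which the variable `c` is sent in the flattening
`cellFlattening`. -/
def cellClass (c : Fin 3 × Fin 3) : Fin 5 :=
  ![![2, 3, 4], ![3, 0, 3], ![4, 3, 1]] c.1 c.2

/-- The Koszul flattening of cubic forms in the entries of a `3 × 3` matrix along the linear map
`ℂ⁹ → ℂ⁵` given by `cellClass`. -/
noncomputable def cellFlattening : homogeneousSubmodule (Fin 3 × Fin 3) ℂ 3 →ₗ[ℂ]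
    Matrix ((Fin 3 × Fin 3) × Fin 5 × Fin 5) ((Fin 3 × Fin 3) × Fin 5 × Fin 5) ℂ :=
  koszulFlattening fun c ↦ Pi.single (cellClass c) 1

/-- The cell in the row and the column missed by `a` and `b`, when these are in distinct rows and in
distinct columns: the row (and the column) indices of the three cells add up to `0` in `ℤ/3`. -/
def thirdCell (a b : Fin 3 × Fin 3) : Fin 3 × Fin 3 := -(a + b)

theorem injective_iff_ne_and_eq_neg_add (i : Fin 3 → Fin 3) :
    Function.Injective i ↔ i 0 ≠ i 1 ∧ i 2 = -(i 0 + i 1) := by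
  decide +revert

theorem injective_fst_and_injective_snd_iff (a b c : Fin 3 × Fin 3) :
    Function.Injective (Prod.fst ∘ ![a, b, c]) ∧ Function.Injective (Prod.snd ∘ ![a, b, c]) ↔
      (a.1 ≠ b.1 ∧ a.2 ≠ b.2) ∧ c = thirdCell a b := by
  rw [injective_iff_ne_and_eq_neg_add, injective_iff_ne_and_eq_neg_add, and_and_and_comm,
    Prod.ext_iff]
  rfl

theorem cellFlattening_ne_zero_iff {χ : Equiv.Perm (Fin 3) → ℂ} (hχ : ∀ s, χ s ≠ 0)
    (a b : Fin 3 × Fin 3) (p q : Fin 5 × Fin 5) :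
    cellFlattening (matrixFunctionForm χ) (a, p) (b, q) ≠ 0 ↔
      (a.1 ≠ b.1 ∧ a.2 ≠ b.2) ∧ WedgeNeZero p (cellClass (thirdCell a b)) q := by
  let D (c : Fin 3 × Fin 3) : ℂ := thirdPartial ![a, b, c] (matrixFunctionForm χ)
  have hD (c : Fin 3 × Fin 3) : D c ≠ 0 ↔ (a.1 ≠ b.1 ∧ a.2 ≠ b.2) ∧ c = thirdCell a b :=
    (thirdPartial_matrixFunctionForm_ne_zero_iff hχ _).trans
      (injective_fst_and_injective_snd_iff a b c)
  have hsum : ∑ c, D c • (Pi.single (cellClass c) 1 : Fin 5 → ℂ) =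
      D (thirdCell a b) • Pi.single (cellClass (thirdCell a b)) 1 :=
    Fintype.sum_eq_single _ fun c hc ↦ by
      rw [not_not.1 fun h ↦ hc ((hD c).1 h).2, zero_smul]
  have hentry : cellFlattening (matrixFunctionForm χ) (a, p) (b, q) =
      D (thirdCell a b) * wedgeMatrix (Pi.single (cellClass (thirdCell a b)) 1) p q := by
    rw [cellFlattening, koszulFlattening_apply, hsum, map_smul, Matrix.smul_apply, smul_eq_mul]
  rw [hentry, mul_ne_zero_iff, hD, wedgeMatrix_single_ne_zero_iff, and_iff_left rfl]

/-- The weight of a column of the flattening, found together with `cellClass` by a computer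
search. -/
def columnWeight (y : (Fin 3 × Fin 3) × Fin 5 × Fin 5) : ℕ :=
  (if y.1.1 = y.1.2 then 0 else 1) +
    ![![0, 0, 0, 1, 1], ![0, 0, 1, 1, 0], ![0, 0, 0, 2, 1], ![0, 0, 0, 0, 2], ![0, 0, 0, 0, 0]]
      y.2.1 y.2.2

/-- An injective key on the columns of the flattening that orders them by weight first. -/
def columnKey (y : (Fin 3 × Fin 3) × Fin 5 × Fin 5) : ℕ :=
  225 * columnWeight y + (45 * y.2.2 + 9 * y.2.1 + 3 * y.1.1 + y.1.2)

/-- In the row `(a, p)`, the last nonzero entry, with respect to `columnKey` and among the columns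
`(b', q')` with `q'` increasing, is that in the column `(b, q)`. -/
def IsLeadingEntry (a : Fin 3 × Fin 3) (p : Fin 5 × Fin 5) (b : Fin 3 × Fin 3)
    (q : Fin 5 × Fin 5) : Prop :=
  WedgeNeZero p (cellClass (thirdCell a b)) q ∧
    ∀ b' : Fin 3 × Fin 3, a.1 ≠ b'.1 ∧ a.2 ≠ b'.2 → ∀ q' : Fin 5 × Fin 5, q'.1 < q'.2 →
      WedgeNeZero p (cellClass (thirdCell a b')) q' → columnKey (b, q) ≤ columnKey (b', q') →
        (b', q') = (b, q)

instance (a : Fin 3 × Fin 3) (p : Fin 5 × Fin 5) (b : Fin 3 × Fin 3) (q : Fin 5 × Fin 5) :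
    Decidable (IsLeadingEntry a p b q) :=
  inferInstanceAs (Decidable (_ ∧ _))

/-- The columns `(b, q)` with `q` increasing that contain the leading entry of some row. -/
def leadingColumns : Finset ((Fin 3 × Fin 3) × Fin 5 × Fin 5) :=
  {y | y.2.1 < y.2.2 ∧ ∃ a, (a.1 ≠ y.1.1 ∧ a.2 ≠ y.1.2) ∧
    ∃ p : Fin 5 × Fin 5, p.1 < p.2 ∧ IsLeadingEntry a p y.1 y.2}

theorem card_leadingColumns : leadingColumns.card = 80 := by
  decide +kernel

theorem rank_cellFlattening_linPow_le (v : Fin 3 × Fin 3 → ℂ) :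
    (cellFlattening (linPow 3 v)).rank ≤ 6 := by
  rw [cellFlattening]
  exact rank_koszulFlattening_linPow_le _ v

theorem le_rank_cellFlattening {χ : Equiv.Perm (Fin 3) → ℂ} (hχ : ∀ s, χ s ≠ 0) :
    80 ≤ (cellFlattening (matrixFunctionForm χ)).rank := by
  rw [← card_leadingColumns]
  refine card_le_rank_of_linearIndepOn_col (linearIndepOn_col_of_leading columnKey ?_)
  rintro ⟨b, q⟩ hy
  obtain ⟨-, a, hab, p, -, hlead, hlast⟩ := (Finset.mem_filter_univ _).1 hy
  refine ⟨(a, p), (cellFlattening_ne_zero_iff hχ a b p q).2 ⟨hab, hlead⟩, ?_⟩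
  rintro ⟨b', q'⟩ hy' hne hkey
  by_contra hentry
  obtain ⟨hab', hwedge⟩ := (cellFlattening_ne_zero_iff hχ a b' p q').1 hentry
  exact hne (hlast b' hab' q' ((Finset.mem_filter_univ _).1 hy').1 hwedge hkey)

end Certificate

theorem theorem1p8_general {χ : Equiv.Perm (Fin 3) → ℂ} (hχ : ∀ s, χ s ≠ 0) :
    14 ≤ symBorderRank (matrixFunctionForm χ) := by
  have hupper := rank_le_symBorderRank_mul (by decide) cellFlattening
    rank_cellFlattening_linPow_le (matrixFunctionForm χ)
  have hlower := le_rank_cellFlattening hχ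
  lia

theorem theorem1p8 : 14 ≤ symBorderRank (detForm 3) ∧ 14 ≤ symBorderRank (permForm 3) := by
  rw [detForm_eq_matrixFunctionForm, permForm_eq_matrixFunctionForm]
  exact ⟨theorem1p8_general fun s ↦ by simp, theorem1p8_general fun _ ↦ one_ne_zero⟩
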